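/- **Theorem (lower bound for the path-length regret).** For $d\ge 1$ let $\Theta=\mathbb{B}^d=\{x\in\mathbb{R}^d:\|x\|\le 1\}$ be the Euclidean unit ball. For $0<\alpha<\beta$ and $M>0$ let $\mathcal{F}_{\alpha,\beta,M}$ be the class of functions $f:\mathbb{R}^d\to\mathbb{R}$ that are $\alpha$-strongly convex, $\beta$-smooth (continuously differentiable with $\beta$-Lipschitz gradient) and satisfy $\max_{x\in\Theta}|f(x)|\le M$. *Protocol.* Losses $f_1,\dots,f_T\in\mathcal{F}_{\alpha,\beta,M}$ are fixed in advance. In round $t=1,\dots,T$ a randomized algorithm $\pi$ plays $z_t=\Phi_t\big(V,(z_k,y_k)_{k<t}\big)\in\Theta$, where $\Phi_t$ is a Borel function and $V$ is an internal random seed, and observes $y_t=f_t(z_t)+\xi_t$. The noise variables $\xi_t$ are independent of each other and of $V$, with a common distribution $F$ satisfying $$\int\log\Big(\frac{dF(u)}{dF(u+v)}\Big)\,dF(u)\le I_0v^2\qquad\text{for all } |v|<v_0,$$ where $0<I_0<\infty$ and $0<v_0\le\infty$ (the integral is a Kullback–Leibler divergence; in particular $F$ is absolutely continuous with respect to these shifts).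 For $P\ge 0$ the path-length regret is $$R^{\mathrm{pat}}(T,P)=\sup\Big\{\sum_{t=1}^T\mathbb{E}\big[f_t(z_t)-f_t(u_t)\big] \;:\; u_1,\dots,u_T\in\Theta,\ \sum_{t=2}^T\|u_t-u_{t-1}\|\le P\Big\}.$$ *Claim.* Let $0<\alpha<\beta$, $\alpha<4M$, $0<I_0<\infty$ and $0<v_0\le\infty$. There is a constant $c_2>0$, depending only on $\alpha,\beta,M,I_0,v_0$ (so not on $d$, $T$ and $P$), such that for all $d\ge1$ and $P\ge0$ there exists $T_0>0$ such that for every $T\ge T_0$, every noise distribution $F$ as above and every randomized algorithm $\pi$, $$\sup_{f_1,\dots,f_T\in\mathcal{F}_{\alpha,\beta,M}}R^{\mathrm{pat}}(T,P)\;\ge\; c_2\,(d^2P)^{2/5}\,T^{3/5}.$$ -/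

import Mathlib

open MeasureTheory Set
open scoped ENNReal

/-- `ℝ^d` with its Euclidean norm. -/
abbrev Euc (d : ℕ) : Type := EuclideanSpace ℝ (Fin d)

/-- The arm set: the closed unit Euclidean ball of `ℝ^d`. -/
def armSet (d : ℕ) : Set (Euc d) := Metric.closedBall 0 1

/-- A function is `β`-smooth if it is continuously differentiable with `β`-Lipschitz gradient. -/
def IsSmoothWith {d : ℕ} (β : ℝ) (f : Euc d → ℝ) : Prop :=
  ContDiff ℝ 1 f ∧ ∀ x z : Euc d, ‖gradient f x - gradient f z‖ ≤ β * ‖x - z‖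

/-- The admissible losses: `α`-strongly convex and `β`-smooth on `ℝ^d`, and bounded by `M` in
absolute value on the arm set. -/
def lossClass (d : ℕ) (α β M : ℝ) : Set (Euc d → ℝ) :=
  {f | StrongConvexOn univ α f ∧ IsSmoothWith β f ∧ ∀ x ∈ armSet d, |f x| ≤ M}

/-- The noise condition `∫ log (dF(u) / dF(u+v)) dF(u) ≤ I₀ v²` for `|v| < v₀`. The measure
`dF(u+v)` is the image of `F` under `u ↦ u - v`; the Kullback-Leibler divergence is infinite
when `F` is not absolutely continuous with respect to it. -/
def ShiftKLCondition (F : Measure ℝ) (I₀ : ℝ) (v₀ : ℝ≥0∞) : Prop :=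
  ∀ v : ℝ, ENNReal.ofReal |v| < v₀ →
    InformationTheory.klDiv F (F.map (fun u => u - v)) ≤ ENNReal.ofReal (I₀ * v ^ 2)

/-- A randomized bandit algorithm with internal randomness in `S`. Rounds are numbered from `0`.
In round `t` it plays a Borel function of its random seed and of the past actions and
observations `(z_k, y_k)`, `k < t`. -/
structure BanditAlgorithm (d : ℕ) (S : Type*) [MeasurableSpace S] where
  act : (t : ℕ) → S → (Fin t → Euc d × ℝ) → Euc d
  measurable_act : ∀ t, Measurable fun p : S × (Fin t → Euc d × ℝ) => act t p.1 p.2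
  act_mem : ∀ t s h, act t s h ∈ armSet d

namespace BanditAlgorithm

variable {d : ℕ} {S : Type*} [MeasurableSpace S]

/-- The pairs `(z_k, y_k)`, `k < t`, produced when the algorithm with seed `s` faces the losses `f`
and the noise `ξ`, where `y_k = f_k (z_k) + ξ_k`. -/
def history (π : BanditAlgorithm d S) (f : ℕ → Euc d → ℝ) (s : S) (ξ : ℕ → ℝ) :
    (t : ℕ) → Fin t → Euc d × ℝ
  | 0 => Fin.elim0
  | t + 1 =>
      Fin.snoc (α := fun _ => Euc d × ℝ) (π.history f s ξ t)
        (π.act t s (π.history f s ξ t), f t (π.act t s (π.history f s ξ t)) + ξ t)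

/-- The action `z_t`. -/
def action (π : BanditAlgorithm d S) (f : ℕ → Euc d → ℝ) (s : S) (ξ : ℕ → ℝ) (t : ℕ) : Euc d :=
  π.act t s (π.history f s ξ t)

/-- The regret `∑_t E[f_t(z_t) - f_t(u_t)]` over `T` rounds against the comparators `u`. The seed
has law `ρ`, the noise variables are independent with law `F`, and seed and noise are
independent. -/
noncomputable def regret (π : BanditAlgorithm d S) (ρ : Measure S) (F : Measure ℝ)
    (f : ℕ → Euc d → ℝ) (T : ℕ) (u : ℕ → Euc d) : ℝ :=
  ∑ t ∈ Finset.range T, ∫ p : S × (ℕ → ℝ), (f t (π.action f p.1 p.2 t) - f t (u t))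
    ∂(ρ.prod (Measure.infinitePi fun _ : ℕ => F))

end BanditAlgorithm

/-- The path-length `∑ ‖u_t - u_{t-1}‖` of the first `T` comparators. -/
noncomputable def pathLength {d : ℕ} (T : ℕ) (u : ℕ → Euc d) : ℝ :=
  ∑ t ∈ Finset.range (T - 1), ‖u (t + 1) - u t‖

/-- The comparator sequences in the arm set with path-length at most `P`. -/
def comparators (d T : ℕ) (P : ℝ) : Set (ℕ → Euc d) :=
  {u | (∀ t < T, u t ∈ armSet d) ∧ pathLength T u ≤ P}

/-- The path-length regret. The supremum is taken in the extended reals. -/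
noncomputable def pathRegret {d : ℕ} {S : Type*} [MeasurableSpace S] (π : BanditAlgorithm d S)
    (ρ : Measure S) (F : Measure ℝ) (f : ℕ → Euc d → ℝ) (T : ℕ) (P : ℝ) : EReal :=
  ⨆ u ∈ comparators d T P, (π.regret ρ F f T u : EReal)

/-!
Split the rounds into blocks of length `L`. In each block the loss is a quadratic of curvature
slightly above `α`, perturbed by a ripple `∑ᵢ rᵢ² sin (xᵢ / rᵢ)` whose signs `rᵢ = ± h` are chosen
separately for each block and coordinate. The ripple has height `d * h ^ 2` but curvature of order
one, so it may be scaled to keep the loss strongly convex and smooth, and it moves the minimiser to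
`w • r` for a constant `w`. A play on the wrong side of zero in some coordinate therefore costs of
order `h ^ 2`.

Flipping one sign changes the losses of a single block, by `O(h ^ 2)`. The chain rule for the
Kullback–Leibler divergence bounds the divergence between the two laws of the play by
`O(L * h ^ 4)`, which is bounded when `L` is about `h⁻⁴`. By the Bretagnolle–Huber inequality the
algorithm then has a constant probability of playing on the wrong side for one of the two signs, and
averaging over all signs gives a regret of order `T * d * h ^ 2` against the minimisers `w • r`. The
path length of the minimisers is of order at most `(T / L) * √d * h = T * √d * h ^ 5`, which leads
to `h` of order `(P / (T * √d)) ^ (1 / 5)`.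
-/

open ProbabilityTheory InformationTheory
open scoped symmDiff

section KullbackLeibler

variable {X Y : Type*} [MeasurableSpace X] [MeasurableSpace Y]

lemma klDiv_restrict_add_klDiv_restrict_compl {μ ν : Measure X} [IsFiniteMeasure μ]
    [IsFiniteMeasure ν] (hμν : μ ≪ ν) {A : Set X} (hA : MeasurableSet A) :
    klDiv (μ.restrict A) (ν.restrict A) + klDiv (μ.restrict Aᶜ) (ν.restrict Aᶜ) = klDiv μ ν := by
  have klDiv_restrict {B : Set X} (hB : MeasurableSet B) :
      klDiv (μ.restrict B) (ν.restrict B) =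
        ∫⁻ x in B, ENNReal.ofReal (klFun (μ.rnDeriv ν x).toReal) ∂ν := by
    have hμ : μ.restrict B = (ν.restrict B).withDensity (μ.rnDeriv ν) := by
      rw [← restrict_withDensity hB, Measure.withDensity_rnDeriv_eq _ _ hμν]
    have hrnDeriv : (μ.restrict B).rnDeriv (ν.restrict B) =ᵐ[ν.restrict B] μ.rnDeriv ν :=
      hμ ▸ Measure.rnDeriv_withDensity _ (Measure.measurable_rnDeriv _ _)
    rw [klDiv_eq_lintegral_klFun_of_ac (hμν.restrict B)]
    exact lintegral_congr_ae (hrnDeriv.mono fun x hx => by simp only [hx])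
  rw [klDiv_restrict hA, klDiv_restrict hA.compl, lintegral_add_compl _ hA,
    klDiv_eq_lintegral_klFun_of_ac hμν]

lemma mul_log_add_mul_log_compl_le_toReal_klDiv {μ ν : Measure X} [IsProbabilityMeasure μ]
    [IsProbabilityMeasure ν] (h : klDiv μ ν ≠ ∞) {A : Set X} (hA : MeasurableSet A) :
    μ.real A * Real.log (μ.real A / ν.real A) + μ.real Aᶜ * Real.log (μ.real Aᶜ / ν.real Aᶜ) ≤
      (klDiv μ ν).toReal := by
  have hμν : μ ≪ ν := (klDiv_ne_top_iff.1 h).1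
  have hsum := ENNReal.ofReal_add_le.trans
    ((add_le_add (mul_log_le_klDiv (μ.restrict A) (ν.restrict A))
      (mul_log_le_klDiv (μ.restrict Aᶜ) (ν.restrict Aᶜ))).trans_eq
        (klDiv_restrict_add_klDiv_restrict_compl hμν hA))
  simp only [measureReal_restrict_apply_univ] at hsum
  have hle := (ENNReal.ofReal_le_iff_le_toReal h).1 hsum
  have hμA : μ.real A + μ.real Aᶜ = 1 := by rw [measureReal_add_measureReal_compl hA, probReal_univ]
  have hνA : ν.real A + ν.real Aᶜ = 1 := by rw [measureReal_add_measureReal_compl hA, probReal_univ]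
  linarith

lemma mul_exp_neg_log_div_div_two_le_sqrt {p q : ℝ} (hp : 0 ≤ p) (hq : 0 ≤ q)
    (hpq : q = 0 → p = 0) : p * Real.exp (-Real.log (p / q) / 2) ≤ √(p * q) := by
  rcases hp.eq_or_lt with rfl | hp
  · simp
  have hq : 0 < q := hq.lt_of_ne' fun h => hp.ne' (hpq h)
  refine Real.le_sqrt_of_sq_le ?_
  rw [mul_pow, ← Real.exp_nat_mul, Nat.cast_ofNat, mul_div_cancel₀ _ two_ne_zero, Real.exp_neg,
    Real.exp_log (div_pos hp hq)]
  field_simp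
  exact le_rfl

/-- The **Bretagnolle–Huber inequality**. -/
theorem exp_neg_toReal_klDiv_div_two_le {μ ν : Measure X} [IsProbabilityMeasure μ]
    [IsProbabilityMeasure ν] (h : klDiv μ ν ≠ ∞) {A : Set X} (hA : MeasurableSet A) :
    Real.exp (-(klDiv μ ν).toReal) / 2 ≤ μ.real A + ν.real Aᶜ := by
  have hμν : μ ≪ ν := (klDiv_ne_top_iff.1 h).1
  have hac {B : Set X} (hB : ν.real B = 0) : μ.real B = 0 := by
    rw [measureReal_eq_zero_iff] at hB ⊢
    exact hμν hB
  set p := μ.real A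
  set q := ν.real A
  set p' := μ.real Aᶜ
  set q' := ν.real Aᶜ
  have hp : p + p' = 1 := by rw [measureReal_add_measureReal_compl hA, probReal_univ]
  have hp0 : 0 ≤ p := measureReal_nonneg
  have hp'0 : 0 ≤ p' := measureReal_nonneg
  have hq0 : 0 ≤ q := measureReal_nonneg
  have hq'0 : 0 ≤ q' := measureReal_nonneg
  have hexp : Real.exp (-(klDiv μ ν).toReal / 2) ≤ √(p * q) + √(p' * q') := calc
    _ ≤ Real.exp (p * (-Real.log (p / q) / 2) + p' * (-Real.log (p' / q') / 2)) := by
      have := mul_log_add_mul_log_compl_le_toReal_klDiv h hA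
      gcongr
      linarith
    _ ≤ p * Real.exp (-Real.log (p / q) / 2) + p' * Real.exp (-Real.log (p' / q') / 2) :=
      convexOn_exp.2 (mem_univ _) (mem_univ _) hp0 hp'0 hp
    _ ≤ √(p * q) + √(p' * q') :=
      add_le_add (mul_exp_neg_log_div_div_two_le_sqrt hp0 hq0 hac)
        (mul_exp_neg_log_div_div_two_le_sqrt hp'0 hq'0 hac)
  have hsq : Real.exp (-(klDiv μ ν).toReal) = Real.exp (-(klDiv μ ν).toReal / 2) ^ 2 := by
    rw [← Real.exp_nat_mul]
    congr 1
    ring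
  have : Real.exp (-(klDiv μ ν).toReal) ≤ 2 * (p + q') := calc
    _ ≤ (√(p * q) + √(p' * q')) ^ 2 := hsq ▸ by gcongr
    _ ≤ 2 * (√(p * q) ^ 2 + √(p' * q') ^ 2) := add_sq_le
    _ = 2 * (p * q + p' * q') := by rw [Real.sq_sqrt (by positivity), Real.sq_sqrt (by positivity)]
    _ ≤ 2 * (p + q') := by
      gcongr
      · exact mul_le_of_le_one_right hp0 measureReal_le_one
      · exact mul_le_of_le_one_left hq'0 measureReal_le_one
  linarith

lemma rnDeriv_compProd_right [MeasurableSpace.CountableOrCountablyGenerated X Y]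
    (μ : Measure X) [IsFiniteMeasure μ] {κ η : Kernel X Y} [IsFiniteKernel κ] [IsFiniteKernel η]
    (hκη : ∀ x, κ x ≪ η x) :
    (μ ⊗ₘ κ).rnDeriv (μ ⊗ₘ η) =ᵐ[μ ⊗ₘ η] fun p => κ.rnDeriv η p.1 p.2 := by
  have hκ : η.withDensity (κ.rnDeriv η) = κ := by
    ext1 x
    exact Kernel.withDensity_rnDeriv_eq (hκη x)
  have : IsSFiniteKernel (η.withDensity (κ.rnDeriv η)) := by rw [hκ]; infer_instance
  have hμκ : μ ⊗ₘ κ = (μ ⊗ₘ η).withDensity fun p => κ.rnDeriv η p.1 p.2 := by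
    rw [← Measure.compProd_withDensity (Kernel.measurable_rnDeriv κ η), hκ]
  rw [hμκ]
  exact Measure.rnDeriv_withDensity _ (Kernel.measurable_rnDeriv κ η)

lemma klDiv_compProd_right_eq_lintegral [MeasurableSpace.CountableOrCountablyGenerated X Y]
    (μ : Measure X) [IsFiniteMeasure μ] {κ η : Kernel X Y} [IsFiniteKernel κ] [IsFiniteKernel η]
    (hκη : ∀ x, κ x ≪ η x) :
    klDiv (μ ⊗ₘ κ) (μ ⊗ₘ η) = ∫⁻ x, klDiv (κ x) (η x) ∂μ := by
  have : Measurable fun p : X × Y => κ.rnDeriv η p.1 p.2 := Kernel.measurable_rnDeriv κ η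
  calc klDiv (μ ⊗ₘ κ) (μ ⊗ₘ η)
      = ∫⁻ p, ENNReal.ofReal (klFun (κ.rnDeriv η p.1 p.2).toReal) ∂(μ ⊗ₘ η) := by
        rw [klDiv_eq_lintegral_klFun_of_ac (.compProd_right (.of_forall hκη))]
        exact lintegral_congr_ae ((rnDeriv_compProd_right μ hκη).mono fun p hp => by simp only [hp])
    _ = ∫⁻ x, ∫⁻ y, ENNReal.ofReal (klFun (κ.rnDeriv η x y).toReal) ∂(η x) ∂μ :=
        Measure.lintegral_compProd (by fun_prop)
    _ = ∫⁻ x, klDiv (κ x) (η x) ∂μ := by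
        refine lintegral_congr fun x => ?_
        rw [klDiv_eq_lintegral_klFun_of_ac (hκη x)]
        exact lintegral_congr_ae
          ((Kernel.rnDeriv_eq_rnDeriv_measure (κ := κ)).mono fun y hy => by simp only [hy])

lemma klDiv_compProd_right_le [MeasurableSpace.CountableOrCountablyGenerated X Y]
    (μ : Measure X) [IsProbabilityMeasure μ] {κ η : Kernel X Y} [IsFiniteKernel κ]
    [IsFiniteKernel η] {c : ℝ≥0∞} (hc : c ≠ ∞) (h : ∀ x, klDiv (κ x) (η x) ≤ c) :
    klDiv (μ ⊗ₘ κ) (μ ⊗ₘ η) ≤ c := by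
  rw [klDiv_compProd_right_eq_lintegral μ fun x =>
    (klDiv_ne_top_iff.1 (ne_top_of_le_ne_top hc (h x))).1]
  exact (lintegral_mono h).trans_eq (by simp)

end KullbackLeibler

section AdditiveNoise

variable {X : Type*} [MeasurableSpace X]

/-- The kernel giving the law of `g x + ξ`, where `ξ` has law `F`, for measurable `g` (and `0` for
any other `g`). -/
noncomputable def additiveNoiseKernel (F : Measure ℝ) (g : X → ℝ) : Kernel X ℝ :=
  (Kernel.id ×ₖ Kernel.const X F).map fun p => g p.1 + p.2

variable (F : Measure ℝ) {g : X → ℝ}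

lemma additiveNoiseKernel_apply [SFinite F] (hg : Measurable g) (x : X) :
    additiveNoiseKernel F g x = F.map fun u => g x + u := by
  rw [additiveNoiseKernel, Kernel.map_apply _ (by fun_prop), Kernel.prod_apply, Kernel.id_apply,
    Kernel.const_apply, Measure.dirac_prod, Measure.map_map (by fun_prop) (by fun_prop)]
  rfl

lemma isMarkovKernel_additiveNoiseKernel [IsProbabilityMeasure F] (hg : Measurable g) :
    IsMarkovKernel (additiveNoiseKernel F g) :=
  Kernel.IsMarkovKernel.map _ (by fun_prop)

lemma compProd_additiveNoiseKernel [SFinite F] (μ : Measure X) [SFinite μ] (hg : Measurable g) :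
    μ ⊗ₘ additiveNoiseKernel F g = (μ.prod F).map fun p => (p.1, g p.1 + p.2) := by
  have hm : Measurable fun p : X × ℝ => (p.1, g p.1 + p.2) := by fun_prop
  have : IsSFiniteKernel (additiveNoiseKernel F g) :=
    inferInstanceAs (IsSFiniteKernel (Kernel.map _ _))
  ext s hs
  rw [Measure.compProd_apply hs, Measure.map_apply hm hs, Measure.prod_apply (hm hs)]
  refine lintegral_congr fun x => ?_
  rw [additiveNoiseKernel_apply F hg, Measure.map_apply (by fun_prop) (measurable_prodMk_left hs)]
  rfl

lemma ShiftKLCondition.klDiv_map_add_le {F : Measure ℝ} [IsFiniteMeasure F] {I₀ : ℝ}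
    {v₀ : ℝ≥0∞} (hF : ShiftKLCondition F I₀ v₀) {a b : ℝ} (hab : ENNReal.ofReal |a - b| < v₀) :
    klDiv (F.map fun u => a + u) (F.map fun u => b + u) ≤
      ENNReal.ofReal (I₀ * (a - b) ^ 2) := by
  have hb : (F.map fun u => b + u) = (F.map fun u => u - (a - b)).map fun u => a + u := by
    rw [Measure.map_map (by fun_prop) (by fun_prop)]
    congr 1
    funext u
    simp only [Function.comp_apply]
    ring
  rw [hb]
  exact (klDiv_map_le _ _ (by fun_prop)).trans (hF _ hab)

lemma ShiftKLCondition.klDiv_additiveNoiseKernel_le {F : Measure ℝ} [IsFiniteMeasure F] {I₀ : ℝ}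
    {v₀ : ℝ≥0∞} (hF : ShiftKLCondition F I₀ v₀) (hI₀ : 0 ≤ I₀) {g g' : X → ℝ} (hg : Measurable g)
    (hg' : Measurable g') {x : X} {δ : ℝ} (hδ : ENNReal.ofReal δ < v₀) (hgg' : |g x - g' x| ≤ δ) :
    klDiv (additiveNoiseKernel F g x) (additiveNoiseKernel F g' x) ≤
      ENNReal.ofReal (I₀ * δ ^ 2) := by
  rw [additiveNoiseKernel_apply F hg, additiveNoiseKernel_apply F hg']
  refine (hF.klDiv_map_add_le ((ENNReal.ofReal_le_ofReal hgg').trans_lt hδ)).trans ?_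
  rw [← sq_abs]
  gcongr

end AdditiveNoise

section Convexity

lemma convexOn_univ_sum {ι E : Type*} [AddCommGroup E] [Module ℝ E] (s : Finset ι)
    {f : ι → E → ℝ} (hf : ∀ i ∈ s, ConvexOn ℝ univ (f i)) :
    ConvexOn ℝ univ fun x => ∑ i ∈ s, f i x := by
  refine ⟨convex_univ, fun x _ y _ a b ha hb hab => ?_⟩
  simp only [smul_eq_mul, Finset.mul_sum, ← Finset.sum_add_distrib]
  exact Finset.sum_le_sum fun i hi => (hf i hi).2 (mem_univ x) (mem_univ y) ha hb hab

lemma fderiv_apply_sub_le_of_convexOn {E : Type*} [NormedAddCommGroup E] [NormedSpace ℝ E]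
    {f : E → ℝ} (hf : ConvexOn ℝ univ f) {f' : E →L[ℝ] ℝ} {x : E} (hf' : HasFDerivAt f f' x)
    (y : E) : f' (y - x) ≤ f y - f x := by
  have hconv : ConvexOn ℝ univ (f ∘ AffineMap.lineMap (k := ℝ) x y) :=
    hf.comp_affineMap (AffineMap.lineMap x y)
  have hderiv : HasDerivAt (f ∘ AffineMap.lineMap (k := ℝ) x y) (f' (y - x)) 0 :=
    HasFDerivAt.comp_hasDerivAt 0 (by simpa using hf') AffineMap.hasDerivAt_lineMap
  simpa [slope_def_field] using
    hconv.le_slope_of_hasDerivAt (mem_univ 0) (mem_univ 1) zero_lt_one hderiv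

lemma sq_norm_sub_le_of_strongConvexOn {E : Type*} [NormedAddCommGroup E] [InnerProductSpace ℝ E]
    [CompleteSpace E] {m : ℝ} {f : E → ℝ} (hf : StrongConvexOn univ m f) {x₀ : E}
    (hx₀ : HasGradientAt f 0 x₀) (x : E) : m / 2 * ‖x - x₀‖ ^ 2 ≤ f x - f x₀ := by
  have hderiv := (hasGradientAt_iff_hasFDerivAt.1 hx₀).sub
    ((hasStrictFDerivAt_norm_sq x₀).hasFDerivAt.const_mul (m / 2))
  have hle := fderiv_apply_sub_le_of_convexOn (strongConvexOn_iff_convex.1 hf) hderiv x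
  simp only [map_zero, zero_sub, neg_apply, smul_apply,
    innerSL_apply_apply, smul_eq_mul, inner_sub_right, real_inner_self_eq_norm_sq,
    nsmul_eq_mul, Nat.cast_ofNat] at hle
  rw [norm_sub_sq_real, real_inner_comm]
  linarith

end Convexity

section Ripple

lemma hasDerivAt_sq_mul_sin_div (r y : ℝ) :
    HasDerivAt (fun y : ℝ => r ^ 2 * Real.sin (y / r)) (r * Real.cos (y / r)) y := by
  refine (((hasDerivAt_id y).div_const r).sin.const_mul (r ^ 2)).congr_deriv ?_
  rcases eq_or_ne r 0 with rfl | hr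
  · simp
  · simp only [id_eq]
    field_simp

lemma abs_mul_cos_div_sub_mul_cos_div_le (r a b : ℝ) :
    |r * Real.cos (a / r) - r * Real.cos (b / r)| ≤ |a - b| := by
  rcases eq_or_ne r 0 with rfl | hr
  · simp
  have hcos : |Real.cos (a / r) - Real.cos (b / r)| ≤ |a / r - b / r| := by
    simpa [Real.dist_eq] using Real.lipschitzWith_cos.dist_le_mul (a / r) (b / r)
  calc |r * Real.cos (a / r) - r * Real.cos (b / r)|
      = |r| * |Real.cos (a / r) - Real.cos (b / r)| := by rw [← mul_sub, abs_mul]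
    _ ≤ |r| * |a / r - b / r| := by gcongr
    _ = |a - b| := by rw [← abs_mul, mul_sub, mul_div_cancel₀ _ hr, mul_div_cancel₀ _ hr]

lemma convexOn_sq_div_two_sub_sq_mul_sin_div (r : ℝ) :
    ConvexOn ℝ univ fun y : ℝ => y ^ 2 / 2 - r ^ 2 * Real.sin (y / r) := by
  have hderiv (y : ℝ) : HasDerivAt (fun y : ℝ => y ^ 2 / 2 - r ^ 2 * Real.sin (y / r))
      (y - r * Real.cos (y / r)) y :=
    (((hasDerivAt_pow 2 y).div_const 2).sub (hasDerivAt_sq_mul_sin_div r y)).congr_deriv (by simp)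
  refine Monotone.convexOn_univ_of_deriv (fun y => (hderiv y).differentiableAt) fun a b hab => ?_
  have hcos := (le_abs_self _).trans (abs_mul_cos_div_sub_mul_cos_div_le r b a)
  rw [abs_of_nonneg (sub_nonneg.2 hab)] at hcos
  rw [(hderiv a).deriv, (hderiv b).deriv]
  linarith

variable {d : ℕ} (r : Euc d)

/-- The oscillating perturbation of a loss, with one wave per coordinate. The size and the sign of
`r i` are the width and the phase of the wave along the `i`-th axis, and `r i = 0` turns it off. -/
noncomputable def ripple (x : Euc d) : ℝ := ∑ i, r i ^ 2 * Real.sin (x i / r i)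

/-- The gradient of `ripple r`. -/
noncomputable def rippleGradient (x : Euc d) : Euc d :=
  WithLp.toLp 2 fun i => r i * Real.cos (x i / r i)

lemma contDiff_ripple {n : WithTop ℕ∞} : ContDiff ℝ n (ripple r) := by
  unfold ripple
  fun_prop

lemma hasGradientAt_ripple (x : Euc d) : HasGradientAt (ripple r) (rippleGradient r x) x := by
  rw [hasGradientAt_iff_hasFDerivAt]
  have hsum := HasFDerivAt.fun_sum (u := Finset.univ) fun i _ =>
    (hasDerivAt_sq_mul_sin_div (r i) (x i)).comp_hasFDerivAt x
      (EuclideanSpace.proj (𝕜 := ℝ) i).hasFDerivAt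
  refine hsum.congr_fderiv ?_
  ext y
  simp [rippleGradient, PiLp.inner_apply, mul_comm]

lemma norm_rippleGradient_sub_le (x z : Euc d) :
    ‖rippleGradient r x - rippleGradient r z‖ ≤ ‖x - z‖ := by
  refine le_of_sq_le_sq ?_ (norm_nonneg _)
  rw [EuclideanSpace.real_norm_sq_eq, EuclideanSpace.real_norm_sq_eq]
  exact Finset.sum_le_sum fun i _ =>
    sq_le_sq.2 (abs_mul_cos_div_sub_mul_cos_div_le (r i) (x i) (z i))

lemma rippleGradient_smul_self (w : ℝ) : rippleGradient r (w • r) = Real.cos w • r := by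
  ext i
  rcases eq_or_ne (r i) 0 with hr | hr
  · simp [rippleGradient, hr]
  · simp [rippleGradient, hr, mul_comm]

lemma convexOn_sq_norm_div_two_sub_ripple :
    ConvexOn ℝ univ fun x => ‖x‖ ^ 2 / 2 - ripple r x := by
  have hcoord (i : Fin d) : ConvexOn ℝ univ fun x : Euc d =>
      x i ^ 2 / 2 - r i ^ 2 * Real.sin (x i / r i) :=
    (convexOn_sq_div_two_sub_sq_mul_sin_div (r i)).comp_linearMap
      (EuclideanSpace.proj (𝕜 := ℝ) i : Euc d →L[ℝ] ℝ).toLinearMap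
  refine (convexOn_univ_sum Finset.univ fun i _ => hcoord i).congr fun x _ => ?_
  simp only [ripple, Finset.sum_sub_distrib, ← Finset.sum_div, EuclideanSpace.real_norm_sq_eq]

lemma abs_ripple_le (x : Euc d) : |ripple r x| ≤ ‖r‖ ^ 2 := by
  rw [EuclideanSpace.real_norm_sq_eq]
  refine (Finset.abs_sum_le_sum_abs _ _).trans (Finset.sum_le_sum fun i _ => ?_)
  rw [abs_mul, abs_sq]
  exact mul_le_of_le_one_right (sq_nonneg _) (Real.abs_sin_le_one _)

lemma abs_ripple_sub_ripple_le {r r' : Euc d} (i : Fin d) (h : ∀ j ≠ i, r j = r' j) (x : Euc d) :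
    |ripple r x - ripple r' x| ≤ r i ^ 2 + r' i ^ 2 := by
  have hsub : ripple r x - ripple r' x =
      r i ^ 2 * Real.sin (x i / r i) - r' i ^ 2 * Real.sin (x i / r' i) := by
    rw [ripple, ripple, ← Finset.sum_sub_distrib]
    exact Finset.sum_eq_single i (fun j _ hj => by rw [h j hj, sub_self]) (by simp)
  rw [hsub]
  refine (abs_sub _ _).trans ?_
  rw [abs_mul, abs_mul, abs_sq, abs_sq]
  gcongr
  · exact mul_le_of_le_one_right (sq_nonneg _) (Real.abs_sin_le_one _)
  · exact mul_le_of_le_one_right (sq_nonneg _) (Real.abs_sin_le_one _)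

end Ripple

section PerturbedLoss

variable {d : ℕ} {γ ε : ℝ} {r : Euc d}

/-- The hard losses: a quadratic perturbed by a ripple. The constant `γ / 4` centres the quadratic,
so that it ranges over `[-γ / 4, γ / 4]` on the arm set. -/
noncomputable def perturbedLoss (γ ε : ℝ) (r x : Euc d) : ℝ :=
  γ / 2 * ‖x‖ ^ 2 - ε * ripple r x - γ / 4

lemma contDiff_perturbedLoss {n : WithTop ℕ∞} : ContDiff ℝ n (perturbedLoss γ ε r) :=
  ((contDiff_const.mul (contDiff_norm_sq ℝ)).sub
    (contDiff_const.mul (contDiff_ripple r))).sub contDiff_const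

lemma hasGradientAt_perturbedLoss (x : Euc d) :
    HasGradientAt (perturbedLoss γ ε r) (γ • x - ε • rippleGradient r x) x := by
  rw [hasGradientAt_iff_hasFDerivAt]
  have hderiv := (((hasStrictFDerivAt_norm_sq x).hasFDerivAt.const_mul (γ / 2)).sub
    ((hasGradientAt_iff_hasFDerivAt.1 (hasGradientAt_ripple r x)).const_mul ε)).sub_const (γ / 4)
  refine hderiv.congr_fderiv ?_
  ext y
  simp only [sub_apply, smul_apply, innerSL_apply_apply, InnerProductSpace.toDual_apply_apply,
    inner_sub_left, real_inner_smul_left, nsmul_eq_mul, smul_eq_mul, Nat.cast_ofNat]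
  ring

lemma isSmoothWith_perturbedLoss (hγ : 0 ≤ γ) (hε : 0 ≤ ε) :
    IsSmoothWith (γ + ε) (perturbedLoss γ ε r) := by
  refine ⟨contDiff_perturbedLoss, fun x z => ?_⟩
  rw [(hasGradientAt_perturbedLoss x).gradient, (hasGradientAt_perturbedLoss z).gradient]
  calc ‖γ • x - ε • rippleGradient r x - (γ • z - ε • rippleGradient r z)‖
      = ‖γ • (x - z) - ε • (rippleGradient r x - rippleGradient r z)‖ := by
        rw [smul_sub, smul_sub, sub_sub_sub_comm]
    _ ≤ γ * ‖x - z‖ + ε * ‖rippleGradient r x - rippleGradient r z‖ := by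
        refine (norm_sub_le _ _).trans_eq ?_
        rw [norm_smul, norm_smul, Real.norm_of_nonneg hγ, Real.norm_of_nonneg hε]
    _ ≤ γ * ‖x - z‖ + ε * ‖x - z‖ := by gcongr; exact norm_rippleGradient_sub_le r x z
    _ = (γ + ε) * ‖x - z‖ := (add_mul _ _ _).symm

lemma strongConvexOn_perturbedLoss (hε : 0 ≤ ε) :
    StrongConvexOn univ (γ - ε) (perturbedLoss γ ε r) := by
  rw [strongConvexOn_iff_convex]
  refine (((convexOn_sq_norm_div_two_sub_ripple r).smul hε).add
    (convexOn_const (-(γ / 4)) convex_univ)).congr fun x _ => ?_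
  simp only [Pi.add_apply, perturbedLoss, smul_eq_mul]
  ring

lemma abs_perturbedLoss_le (hγ : 0 ≤ γ) (hε : 0 ≤ ε) {x : Euc d} (hx : x ∈ armSet d) :
    |perturbedLoss γ ε r x| ≤ γ / 4 + ε * ‖r‖ ^ 2 := by
  have hx_sq : ‖x‖ ^ 2 ≤ 1 := pow_le_one₀ (norm_nonneg x) (mem_closedBall_zero_iff.1 hx)
  have hripple := abs_le.1 (abs_ripple_le r x)
  rw [perturbedLoss, abs_le]
  constructor <;> nlinarith [sq_nonneg ‖x‖]

lemma perturbedLoss_mem_lossClass {α β M : ℝ} (hγ : 0 ≤ γ) (hε : 0 ≤ ε) (hα : α ≤ γ - ε)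
    (hβ : γ + ε ≤ β) (hM : γ / 4 + ε * ‖r‖ ^ 2 ≤ M) : perturbedLoss γ ε r ∈ lossClass d α β M := by
  have hsmooth : IsSmoothWith (γ + ε) (perturbedLoss γ ε r) := isSmoothWith_perturbedLoss hγ hε
  exact ⟨(strongConvexOn_perturbedLoss hε).mono hα,
    ⟨hsmooth.1, fun x z => (hsmooth.2 x z).trans (by gcongr)⟩,
    fun x hx => (abs_perturbedLoss_le hγ hε hx).trans hM⟩

lemma abs_perturbedLoss_sub_le (hε : 0 ≤ ε) {r' : Euc d} (i : Fin d) (h : ∀ j ≠ i, r j = r' j)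
    (x : Euc d) :
    |perturbedLoss γ ε r x - perturbedLoss γ ε r' x| ≤ ε * (r i ^ 2 + r' i ^ 2) := by
  have hsub : perturbedLoss γ ε r x - perturbedLoss γ ε r' x =
      -(ε * (ripple r x - ripple r' x)) := by
    simp only [perturbedLoss]
    ring
  rw [hsub, abs_neg, abs_mul, abs_of_nonneg hε]
  gcongr
  exact abs_ripple_sub_ripple_le i h x

lemma exists_mul_eq_mul_cos (hε : 0 < ε) (hεγ : ε ≤ γ) :
    ∃ w : ℝ, 0 < w ∧ w ≤ 1 ∧ γ * w = ε * Real.cos w := by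
  have hcont : ContinuousOn (fun w : ℝ => γ * w - ε * Real.cos w) (Icc 0 1) := by fun_prop
  have hends : (0 : ℝ) ∈ Icc (γ * 0 - ε * Real.cos 0) (γ * 1 - ε * Real.cos 1) := by
    rw [Real.cos_zero, mem_Icc]
    constructor
    · linarith
    · nlinarith [Real.cos_le_one 1]
  obtain ⟨w, ⟨hw0, hw1⟩, hw⟩ := intermediate_value_Icc zero_le_one hcont hends
  refine ⟨w, hw0.lt_of_ne ?_, hw1, sub_eq_zero.1 hw⟩
  rintro rfl
  simp [hε.ne'] at hw

variable {w : ℝ}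

lemma sq_norm_sub_le_perturbedLoss_sub (hε : 0 ≤ ε) (hw : γ * w = ε * Real.cos w) (x : Euc d) :
    (γ - ε) / 2 * ‖x - w • r‖ ^ 2 ≤ perturbedLoss γ ε r x - perturbedLoss γ ε r (w • r) := by
  refine sq_norm_sub_le_of_strongConvexOn (strongConvexOn_perturbedLoss hε) ?_ x
  have hgrad : γ • w • r - ε • rippleGradient r (w • r) = 0 := by
    rw [rippleGradient_smul_self, smul_smul, smul_smul, hw, sub_self]
  exact hgrad ▸ hasGradientAt_perturbedLoss (w • r)

/-- The points whose `i`-th coordinate does not have the sign of `r i`. Playing there against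
`perturbedLoss γ ε r` misses the minimiser `w • r` by at least `w * |r i|` in that coordinate. -/
def wrongSignSet (r : Euc d) (i : Fin d) : Set (Euc d) := {x | x i * r i ≤ 0}

lemma measurableSet_wrongSignSet (r : Euc d) (i : Fin d) : MeasurableSet (wrongSignSet r i) :=
  measurableSet_le (by fun_prop) measurable_const

lemma compl_wrongSignSet_subset {r r' : Euc d} {i : Fin d} (h : r' i = -r i) :
    (wrongSignSet r i)ᶜ ⊆ wrongSignSet r' i := by
  intro x hx
  have hx : 0 < x i * r i := not_le.1 hx
  change x i * r' i ≤ 0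
  rw [h, mul_neg]
  exact (neg_neg_of_pos hx).le

lemma sum_indicator_le_perturbedLoss_sub (hε : 0 ≤ ε) (hεγ : ε ≤ γ) (hw0 : 0 ≤ w)
    (hw : γ * w = ε * Real.cos w) (x : Euc d) :
    ∑ i, (wrongSignSet r i).indicator (fun _ => (γ - ε) / 2 * (w * r i) ^ 2) x ≤
      perturbedLoss γ ε r x - perturbedLoss γ ε r (w • r) := by
  refine le_trans ?_ (sq_norm_sub_le_perturbedLoss_sub hε hw x)
  rw [EuclideanSpace.real_norm_sq_eq, Finset.mul_sum]
  have hγε : 0 ≤ (γ - ε) / 2 := by linarith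
  refine Finset.sum_le_sum fun i _ => indicator_apply_le' (fun hx => ?_) fun _ => ?_
  · have hx : x i * r i ≤ 0 := hx
    refine mul_le_mul_of_nonneg_left ?_ hγε
    simp only [PiLp.sub_apply, PiLp.smul_apply, smul_eq_mul]
    nlinarith [sq_nonneg (x i)]
  · positivity

lemma sum_measureReal_le_integral_perturbedLoss_sub (hε : 0 ≤ ε) (hεγ : ε ≤ γ) (hw0 : 0 ≤ w)
    (hw : γ * w = ε * Real.cos w) {μ : Measure (Euc d)} [IsFiniteMeasure μ]
    (hμ : Integrable (perturbedLoss γ ε r) μ) :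
    ∑ i, (γ - ε) / 2 * (w * r i) ^ 2 * μ.real (wrongSignSet r i) ≤
      ∫ x, (perturbedLoss γ ε r x - perturbedLoss γ ε r (w • r)) ∂μ := by
  have hint (i : Fin d) : Integrable
      ((wrongSignSet r i).indicator fun _ => (γ - ε) / 2 * (w * r i) ^ 2) μ :=
    (integrable_const _).indicator (measurableSet_wrongSignSet r i)
  calc ∑ i, (γ - ε) / 2 * (w * r i) ^ 2 * μ.real (wrongSignSet r i)
      = ∫ x, ∑ i, (wrongSignSet r i).indicator
          (fun _ => (γ - ε) / 2 * (w * r i) ^ 2) x ∂μ := by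
        rw [integral_finsetSum _ fun i _ => hint i]
        refine Finset.sum_congr rfl fun i _ => ?_
        rw [integral_indicator_const _ (measurableSet_wrongSignSet r i), smul_eq_mul, mul_comm]
    _ ≤ _ := integral_mono (integrable_finsetSum _ fun i _ => hint i)
        (hμ.sub (integrable_const _)) (sum_indicator_le_perturbedLoss_sub hε hεγ hw0 hw)

end PerturbedLoss

section ProductMeasure

variable {ι : Type*} [DecidableEq ι] {X : ι → Type*} [∀ i, MeasurableSpace (X i)]
  (μ : ∀ i, Measure (X i)) [∀ i, IsProbabilityMeasure (μ i)]

lemma map_update_infinitePi_prod (i : ι) :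
    ((Measure.infinitePi μ).prod (μ i)).map (fun p => Function.update p.1 i p.2) =
      Measure.infinitePi μ := by
  refine Measure.eq_infinitePi _ fun s B hB => ?_
  rw [Measure.map_apply measurable_update' (.pi s.countable_toSet fun j _ => hB j)]
  have hpre : (fun p : (∀ j, X j) × X i => Function.update p.1 i p.2) ⁻¹' Set.pi s B =
      Set.pi (s.erase i) B ×ˢ (if i ∈ s then B i else univ) := by
    ext p
    simp only [mem_preimage, Set.mem_pi, mem_prod, Finset.mem_coe, Finset.mem_erase]
    constructor
    · intro h
      refine ⟨fun j hj => by simpa [hj.1] using h j hj.2, ?_⟩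
      split_ifs with hi
      · simpa using h i hi
      · trivial
    · rintro ⟨h1, h2⟩ j hj
      by_cases hji : j = i
      · subst hji
        simpa [hj] using h2
      · simpa [hji] using h1 j ⟨hji, hj⟩
  rw [hpre, Measure.prod_prod, Measure.infinitePi_pi _ fun j _ => hB j]
  split_ifs with hi
  · rw [mul_comm, Finset.mul_prod_erase s (fun j => μ j (B j)) hi]
  · rw [Finset.erase_eq_of_notMem hi, measure_univ, mul_one]

lemma map_prodMk_eval_eq_prod {S Y : Type*} [MeasurableSpace S] [MeasurableSpace Y]
    (ρ : Measure S) [IsProbabilityMeasure ρ] (i : ι) {G : S × (∀ j, X j) → Y} (hG : Measurable G)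
    (hGi : ∀ s ξ u, G (s, Function.update ξ i u) = G (s, ξ)) :
    (ρ.prod (Measure.infinitePi μ)).map (fun p => (G p, p.2 i)) =
      ((ρ.prod (Measure.infinitePi μ)).map G).prod (μ i) := by
  have hupdate : Measurable fun p : (∀ j, X j) × X i => Function.update p.1 i p.2 :=
    measurable_update'
  have hresample : ρ.prod (Measure.infinitePi μ) =
      (ρ.prod ((Measure.infinitePi μ).prod (μ i))).map
        (Prod.map id fun p => Function.update p.1 i p.2) := by
    rw [← Measure.map_prod_map _ _ measurable_id hupdate, Measure.map_id,
      map_update_infinitePi_prod]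
  have hG_prod := Measure.map_prod_map (ρ.prod (Measure.infinitePi μ)) (μ i) hG measurable_id
  rw [Measure.map_id] at hG_prod
  conv_lhs => rw [hresample]
  rw [Measure.map_map (by fun_prop) (by fun_prop), ← Measure.prodAssoc_prod,
    Measure.map_map (by fun_prop) (by fun_prop), hG_prod]
  congr 1
  funext p
  exact Prod.ext (hGi _ _ _) (Function.update_self _ _ _)

end ProductMeasure

lemma measurable_snoc {A X : Type*} [MeasurableSpace A] [MeasurableSpace X] {t : ℕ}
    {g : X → Fin t → A} {a : X → A} (hg : Measurable g) (ha : Measurable a) :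
    Measurable fun x => (Fin.snoc (α := fun _ => A) (g x) (a x) : Fin (t + 1) → A) := by
  refine measurable_pi_iff.2 fun i => Fin.lastCases ?_ (fun j => ?_) i
  · simpa using ha
  · simpa using hg.eval

namespace BanditAlgorithm

variable {d : ℕ} {S : Type*} [MeasurableSpace S] (π : BanditAlgorithm d S)

/-- Appends the action and the observation `y` of round `t` to the history. -/
def extend (t : ℕ) (p : (S × (Fin t → Euc d × ℝ)) × ℝ) : S × (Fin (t + 1) → Euc d × ℝ) :=
  (p.1.1, Fin.snoc (α := fun _ => Euc d × ℝ) p.1.2 (π.act t p.1.1 p.1.2, p.2))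

lemma measurable_extend (t : ℕ) : Measurable (π.extend t) := by
  have hact := (π.measurable_act t).comp
    (measurable_fst : Measurable fun p : (S × (Fin t → Euc d × ℝ)) × ℝ => p.1)
  exact Measurable.prodMk (by fun_prop) (measurable_snoc (by fun_prop) (hact.prodMk measurable_snd))

variable {f f' : ℕ → Euc d → ℝ}

lemma measurable_loss_act (hf : ∀ t, Measurable (f t)) (t : ℕ) :
    Measurable fun p : S × (Fin t → Euc d × ℝ) => f t (π.act t p.1 p.2) :=
  (hf t).comp (π.measurable_act t)

lemma measurable_history (hf : ∀ t, Measurable (f t)) (t : ℕ) :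
    Measurable fun p : S × (ℕ → ℝ) => (p.1, π.history f p.1 p.2 t) := by
  induction t with
  | zero => exact measurable_fst.prodMk measurable_const
  | succ t ih =>
    have hloss : Measurable fun p : S × (ℕ → ℝ) => f t (π.act t p.1 (π.history f p.1 p.2 t)) :=
      (π.measurable_loss_act hf t).comp ih
    exact (π.measurable_extend t).comp (ih.prodMk (hloss.add (by fun_prop)))

lemma measurable_action (hf : ∀ t, Measurable (f t)) (t : ℕ) :
    Measurable fun p : S × (ℕ → ℝ) => π.action f p.1 p.2 t :=
  (π.measurable_act t).comp (π.measurable_history hf t)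

lemma history_update (s : S) (ξ : ℕ → ℝ) {t k : ℕ} (htk : t ≤ k) (u : ℝ) :
    π.history f s (Function.update ξ k u) t = π.history f s ξ t := by
  induction t with
  | zero => rfl
  | succ t ih => rw [history, history, ih (by lia), Function.update_of_ne (by lia)]

/-- The joint law of the seed and of the history before round `t`. -/
noncomputable def historyLaw (ρ : Measure S) (F : Measure ℝ) (f : ℕ → Euc d → ℝ) (t : ℕ) :
    Measure (S × (Fin t → Euc d × ℝ)) :=
  (ρ.prod (Measure.infinitePi fun _ : ℕ => F)).map fun p => (p.1, π.history f p.1 p.2 t)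

/-- The law of the action `z_t`. -/
noncomputable def actionLaw (ρ : Measure S) (F : Measure ℝ) (f : ℕ → Euc d → ℝ) (t : ℕ) :
    Measure (Euc d) :=
  (ρ.prod (Measure.infinitePi fun _ : ℕ => F)).map fun p => π.action f p.1 p.2 t

variable (ρ : Measure S) (F : Measure ℝ)

lemma actionLaw_eq_map_historyLaw (hf : ∀ t, Measurable (f t)) (t : ℕ) :
    π.actionLaw ρ F f t = (π.historyLaw ρ F f t).map fun p => π.act t p.1 p.2 :=
  (Measure.map_map (π.measurable_act t) (π.measurable_history hf t)).symm

lemma regret_eq_sum_integral_actionLaw (hf : ∀ t, Continuous (f t)) (T : ℕ) (u : ℕ → Euc d) :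
    π.regret ρ F f T u =
      ∑ t ∈ Finset.range T, ∫ x, (f t x - f t (u t)) ∂π.actionLaw ρ F f t := by
  refine Finset.sum_congr rfl fun t _ => ?_
  exact (integral_map (π.measurable_action (fun t => (hf t).measurable) t).aemeasurable
    ((hf t).sub continuous_const).aestronglyMeasurable).symm

variable [IsProbabilityMeasure ρ] [IsProbabilityMeasure F]

lemma isProbabilityMeasure_historyLaw (hf : ∀ t, Measurable (f t)) (t : ℕ) :
    IsProbabilityMeasure (π.historyLaw ρ F f t) :=
  Measure.isProbabilityMeasure_map (π.measurable_history hf t).aemeasurable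

lemma historyLaw_succ (hf : ∀ t, Measurable (f t)) (t : ℕ) :
    π.historyLaw ρ F f (t + 1) =
      (π.historyLaw ρ F f t ⊗ₘ additiveNoiseKernel F fun p => f t (π.act t p.1 p.2)).map
        (π.extend t) := by
  have := π.isProbabilityMeasure_historyLaw ρ F hf t
  have hloss := π.measurable_loss_act hf t
  have hobs : Measurable fun p : (S × (Fin t → Euc d × ℝ)) × ℝ =>
      (p.1, f t (π.act t p.1.1 p.1.2) + p.2) :=
    measurable_fst.prodMk ((hloss.comp measurable_fst).add measurable_snd)
  have hhist := π.measurable_history hf t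
  have hhist_noise : Measurable fun p : S × (ℕ → ℝ) => ((p.1, π.history f p.1 p.2 t), p.2 t) :=
    hhist.prodMk (by fun_prop)
  rw [compProd_additiveNoiseKernel F _ hloss, historyLaw, historyLaw,
    ← map_prodMk_eval_eq_prod (fun _ => F) ρ t hhist fun s ξ u => by
      rw [π.history_update s ξ le_rfl u],
    Measure.map_map hobs hhist_noise,
    Measure.map_map (π.measurable_extend t) (hobs.comp hhist_noise)]
  rfl

variable {F} in
lemma klDiv_historyLaw_le {I₀ : ℝ} {v₀ : ℝ≥0∞} (hF : ShiftKLCondition F I₀ v₀) (hI₀ : 0 ≤ I₀)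
    (hf : ∀ t, Measurable (f t)) (hf' : ∀ t, Measurable (f' t)) {δ : ℕ → ℝ} (t : ℕ)
    (hδ : ∀ k < t, ENNReal.ofReal (δ k) < v₀) (hff' : ∀ k < t, ∀ x, |f k x - f' k x| ≤ δ k) :
    klDiv (π.historyLaw ρ F f t) (π.historyLaw ρ F f' t) ≤
      ∑ k ∈ Finset.range t, ENNReal.ofReal (I₀ * δ k ^ 2) := by
  induction t with
  | zero =>
    have := π.isProbabilityMeasure_historyLaw ρ F hf 0
    have hzero : π.historyLaw ρ F f 0 = π.historyLaw ρ F f' 0 := rfl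
    rw [← hzero, klDiv_self]
    exact zero_le
  | succ t ih =>
    have := π.isProbabilityMeasure_historyLaw ρ F hf t
    have := π.isProbabilityMeasure_historyLaw ρ F hf' t
    have := isMarkovKernel_additiveNoiseKernel F (π.measurable_loss_act hf t)
    have := isMarkovKernel_additiveNoiseKernel F (π.measurable_loss_act hf' t)
    rw [π.historyLaw_succ ρ F hf, π.historyLaw_succ ρ F hf', Finset.sum_range_succ]
    refine (klDiv_map_le _ _ (π.measurable_extend t)).trans ?_
    rw [klDiv_compProd_eq_add]
    exact add_le_add (ih (fun k hk => hδ k (by lia)) fun k hk => hff' k (by lia))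
      (klDiv_compProd_right_le _ ENNReal.ofReal_ne_top fun p =>
        hF.klDiv_additiveNoiseKernel_le hI₀ (π.measurable_loss_act hf t)
          (π.measurable_loss_act hf' t) (hδ t t.lt_succ_self) (hff' t t.lt_succ_self _))

lemma isProbabilityMeasure_actionLaw (hf : ∀ t, Measurable (f t)) (t : ℕ) :
    IsProbabilityMeasure (π.actionLaw ρ F f t) :=
  Measure.isProbabilityMeasure_map (π.measurable_action hf t).aemeasurable

variable {F} in
lemma klDiv_actionLaw_le {I₀ : ℝ} {v₀ : ℝ≥0∞} (hF : ShiftKLCondition F I₀ v₀) (hI₀ : 0 ≤ I₀)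
    (hf : ∀ t, Measurable (f t)) (hf' : ∀ t, Measurable (f' t)) {δ : ℕ → ℝ} (t : ℕ)
    (hδ : ∀ k < t, ENNReal.ofReal (δ k) < v₀) (hff' : ∀ k < t, ∀ x, |f k x - f' k x| ≤ δ k) :
    klDiv (π.actionLaw ρ F f t) (π.actionLaw ρ F f' t) ≤
      ∑ k ∈ Finset.range t, ENNReal.ofReal (I₀ * δ k ^ 2) := by
  have := π.isProbabilityMeasure_historyLaw ρ F hf t
  have := π.isProbabilityMeasure_historyLaw ρ F hf' t
  rw [π.actionLaw_eq_map_historyLaw ρ F hf, π.actionLaw_eq_map_historyLaw ρ F hf']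
  exact (klDiv_map_le _ _ (π.measurable_act t)).trans
    (π.klDiv_historyLaw_le ρ hF hI₀ hf hf' t hδ hff')

lemma integrable_actionLaw (hf : ∀ t, Measurable (f t)) (t : ℕ) {g : Euc d → ℝ}
    (hg : Continuous g) : Integrable g (π.actionLaw ρ F f t) := by
  have := π.isProbabilityMeasure_actionLaw ρ F hf t
  have hmem : ∀ᵐ x ∂π.actionLaw ρ F f t, x ∈ armSet d :=
    (ae_map_iff (π.measurable_action hf t).aemeasurable
      Metric.isClosed_closedBall.measurableSet).2 (.of_forall fun p => π.act_mem t _ _)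
  rw [← Measure.restrict_eq_self_of_ae_mem hmem]
  exact hg.continuousOn.integrableOn_compact (isCompact_closedBall 0 1)

end BanditAlgorithm

section Blocks

lemma card_filter_div_eq_le {L : ℕ} (hL : 0 < L) (s : Finset ℕ) (q : ℕ) :
    (s.filter fun k => k / L = q).card ≤ L := by
  have hsub : (s.filter fun k => k / L = q) ⊆ Finset.Ico (L * q) (L * q + L) := by
    intro k hk
    obtain ⟨_, rfl⟩ := Finset.mem_filter.1 hk
    have hlt := Nat.lt_mul_div_succ k hL
    exact Finset.mem_Ico.2 ⟨Nat.mul_div_le k L, by rwa [mul_add, mul_one] at hlt⟩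
  simpa using Finset.card_le_card hsub

lemma pathLength_comp_div_le {d : ℕ} {v : ℕ → Euc d} {C : ℝ} (hv : ∀ q, ‖v (q + 1) - v q‖ ≤ C)
    (L T : ℕ) : pathLength T (fun t => v (t / L)) ≤ ((T - 1) / L : ℕ) * C := by
  have hstep (t : ℕ) : ‖v ((t + 1) / L) - v (t / L)‖ ≤
      (((t + 1) / L : ℕ) - (t / L : ℕ) : ℝ) * C := by
    rw [Nat.succ_div]
    split_ifs
    · simpa using hv (t / L)
    · simp
  refine (Finset.sum_le_sum fun t _ => hstep t).trans_eq ?_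
  rw [← Finset.sum_mul, Finset.sum_range_sub fun t => ((t / L : ℕ) : ℝ), Nat.zero_div,
    Nat.cast_zero, sub_zero]

end Blocks

section Assouad

/-- **Assouad's lemma**, in the form of an averaging argument over sign patterns: a pattern is the
set of its positive indices, and flipping the sign `i` is taking the symmetric difference with
`{i}`. -/
lemma exists_card_mul_le_sum {ι J : Type*} [DecidableEq ι] (s : Finset J) (p : J → ι)
    (e : Finset ι → J → ℝ) {a : ℝ} (h : ∀ σ, ∀ j ∈ s, a ≤ e σ j + e (σ ∆ {p j}) j) :
    ∃ σ, s.card * (a / 2) ≤ ∑ j ∈ s, e σ j := by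
  let patterns := (s.image p).powerset
  have hflip (j : J) (hj : j ∈ s) :
      ∑ σ ∈ patterns, e (σ ∆ {p j}) j = ∑ σ ∈ patterns, e σ j := by
    have hmem (σ : Finset ι) (hσ : σ ∈ patterns) : σ ∆ {p j} ∈ patterns := by
      rw [Finset.mem_powerset] at hσ ⊢
      exact symmDiff_le_sup.trans
        (Finset.union_subset hσ (Finset.singleton_subset_iff.2 (Finset.mem_image_of_mem p hj)))
    exact Finset.sum_nbij' (· ∆ {p j}) (· ∆ {p j}) hmem hmem (by simp) (by simp) (by simp)
  have hsum (j : J) (hj : j ∈ s) : patterns.card * (a / 2) ≤ ∑ σ ∈ patterns, e σ j := by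
    have := Finset.card_nsmul_le_sum patterns _ a fun σ _ => h σ j hj
    rw [Finset.sum_add_distrib, hflip j hj, nsmul_eq_mul] at this
    linarith
  obtain ⟨σ, -, hσ⟩ := Finset.exists_le_of_sum_le (s := patterns)
    (f := fun _ => s.card * (a / 2)) (g := fun σ => ∑ j ∈ s, e σ j) (Finset.powerset_nonempty _)
    (by
      rw [Finset.sum_comm, Finset.sum_const, nsmul_eq_mul, mul_left_comm, ← nsmul_eq_mul]
      exact Finset.card_nsmul_le_sum s _ _ hsum)
  exact ⟨σ, hσ⟩

variable {d : ℕ} {h : ℝ} (σ : Finset (ℕ × Fin d)) (q : ℕ)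

/-- The vector with coordinates `± h`, whose `i`-th sign is positive iff `(q, i) ∈ σ`. Here `q` is
the number of a block of rounds, so that `σ` prescribes a sign for each block and each
coordinate. -/
noncomputable def signVector (h : ℝ) (σ : Finset (ℕ × Fin d)) (q : ℕ) : Euc d :=
  WithLp.toLp 2 fun i => if (q, i) ∈ σ then h else -h

lemma signVector_apply_sq (i : Fin d) : signVector h σ q i ^ 2 = h ^ 2 := by
  simp only [signVector]
  split_ifs
  · rfl
  · exact neg_sq h

lemma norm_signVector_sq : ‖signVector h σ q‖ ^ 2 = d * h ^ 2 := by
  simp [EuclideanSpace.real_norm_sq_eq, signVector_apply_sq]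

lemma norm_signVector (hh : 0 ≤ h) : ‖signVector h σ q‖ = √d * h := by
  rw [← Real.sqrt_sq (norm_nonneg _), norm_signVector_sq, Real.sqrt_mul (Nat.cast_nonneg d),
    Real.sqrt_sq hh]

lemma signVector_symmDiff_singleton_self (i : Fin d) :
    signVector h (σ ∆ {(q, i)}) q i = -signVector h σ q i := by
  by_cases hi : (q, i) ∈ σ <;> simp [signVector, Finset.mem_symmDiff, hi]

variable {q}

lemma signVector_symmDiff_singleton_of_ne {q' : ℕ} {i j : Fin d} (hne : (q', j) ≠ (q, i)) :
    signVector h (σ ∆ {(q, i)}) q' j = signVector h σ q' j := by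
  simp only [signVector, Finset.mem_symmDiff, Finset.mem_singleton, hne, not_false_eq_true,
    and_true, false_and, or_false]

lemma signVector_symmDiff_singleton_of_block_ne {q' : ℕ} (i : Fin d) (hne : q' ≠ q) :
    signVector h (σ ∆ {(q, i)}) q' = signVector h σ q' := by
  ext j
  exact signVector_symmDiff_singleton_of_ne σ fun heq => hne (Prod.ext_iff.1 heq).1

end Assouad

section BlockLoss

variable {d : ℕ} (γ ε h : ℝ) (L : ℕ) (σ : Finset (ℕ × Fin d))

/-- The losses which, in every round `t` of a block `t / L` of `L` rounds, are the perturbed loss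
with the signs that `σ` prescribes for that block. -/
noncomputable def blockLoss (t : ℕ) : Euc d → ℝ :=
  perturbedLoss γ ε (signVector h σ (t / L))

lemma continuous_blockLoss (t : ℕ) : Continuous (blockLoss γ ε h L σ t) :=
  (contDiff_perturbedLoss (n := 0)).continuous

lemma measurable_blockLoss (t : ℕ) : Measurable (blockLoss γ ε h L σ t) :=
  (continuous_blockLoss γ ε h L σ t).measurable

variable {γ ε h L}

lemma abs_blockLoss_sub_symmDiff_singleton_le (hε : 0 ≤ ε) (t q : ℕ) (i : Fin d) (x : Euc d) :
    |blockLoss γ ε h L σ t x - blockLoss γ ε h L (σ ∆ {(q, i)}) t x| ≤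
      if t / L = q then 2 * ε * h ^ 2 else 0 := by
  rw [blockLoss, blockLoss]
  split_ifs with hq
  · subst hq
    refine (abs_perturbedLoss_sub_le hε i (fun j hj => ?_) x).trans_eq ?_
    · exact (signVector_symmDiff_singleton_of_ne σ fun heq => hj (Prod.ext_iff.1 heq).2).symm
    · rw [signVector_apply_sq, signVector_apply_sq]
      ring
  · rw [signVector_symmDiff_singleton_of_block_ne σ i hq, sub_self, abs_zero]

lemma smul_signVector_mem_comparators {T : ℕ} {w P : ℝ} (hw0 : 0 ≤ w) (hw1 : w ≤ 1) (hh : 0 ≤ h)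
    (hd : d * h ^ 2 ≤ 1) (hP : ((T - 1) / L : ℕ) * (2 * √d * h) ≤ P) :
    (fun t => w • signVector h σ (t / L)) ∈ comparators d T P := by
  have hnorm (q : ℕ) : ‖w • signVector h σ q‖ ≤ √d * h := by
    rw [norm_smul, Real.norm_of_nonneg hw0, norm_signVector σ q hh]
    exact mul_le_of_le_one_left (by positivity) hw1
  refine ⟨fun t _ => mem_closedBall_zero_iff.2 ((hnorm _).trans ?_), le_trans ?_ hP⟩
  · rw [← norm_signVector σ 0 hh, ← sq_le_one_iff₀ (norm_nonneg _), norm_signVector_sq]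
    exact hd
  · refine pathLength_comp_div_le (v := fun q => w • signVector h σ q) (fun q => ?_) L T
    linarith [norm_sub_le (w • signVector h σ (q + 1)) (w • signVector h σ q), hnorm q,
      hnorm (q + 1)]

end BlockLoss

namespace BanditAlgorithm

variable {d : ℕ} {S : Type*} [MeasurableSpace S] (π : BanditAlgorithm d S) (ρ : Measure S)
  [IsProbabilityMeasure ρ] {F : Measure ℝ} [IsProbabilityMeasure F] {γ ε h I₀ K : ℝ} {v₀ : ℝ≥0∞}
  {L : ℕ}

lemma klDiv_actionLaw_blockLoss_le (hε : 0 ≤ ε) (hF : ShiftKLCondition F I₀ v₀) (hI₀ : 0 ≤ I₀)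
    (hv : ENNReal.ofReal (2 * ε * h ^ 2) < v₀) (hL : 0 < L)
    (hK : L * (I₀ * (2 * ε * h ^ 2) ^ 2) ≤ K) (σ : Finset (ℕ × Fin d)) (t q : ℕ) (i : Fin d) :
    klDiv (π.actionLaw ρ F (blockLoss γ ε h L σ) t)
      (π.actionLaw ρ F (blockLoss γ ε h L (σ ∆ {(q, i)})) t) ≤ ENNReal.ofReal K := by
  have hδ (k : ℕ) : ENNReal.ofReal (if k / L = q then 2 * ε * h ^ 2 else 0) < v₀ := by
    split_ifs
    · exact hv
    · exact ENNReal.ofReal_zero.trans_lt (bot_le.trans_lt hv)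
  refine (π.klDiv_actionLaw_le ρ hF hI₀ (measurable_blockLoss γ ε h L σ)
    (measurable_blockLoss γ ε h L _) t (fun k _ => hδ k) fun k _ =>
      abs_blockLoss_sub_symmDiff_singleton_le σ hε k q i).trans ?_
  rw [← ENNReal.ofReal_sum_of_nonneg fun k _ => by positivity]
  refine ENNReal.ofReal_le_ofReal (le_trans ?_ hK)
  simp only [ite_pow, mul_ite, zero_pow two_ne_zero, mul_zero, ← Finset.sum_filter,
    Finset.sum_const, nsmul_eq_mul]
  gcongr
  exact card_filter_div_eq_le hL _ q

lemma exp_neg_div_two_le_measureReal_wrongSignSet_add (hε : 0 ≤ ε) (hF : ShiftKLCondition F I₀ v₀)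
    (hI₀ : 0 ≤ I₀) (hv : ENNReal.ofReal (2 * ε * h ^ 2) < v₀) (hL : 0 < L)
    (hK : L * (I₀ * (2 * ε * h ^ 2) ^ 2) ≤ K) (σ : Finset (ℕ × Fin d)) (t : ℕ) (i : Fin d) :
    Real.exp (-K) / 2 ≤
      (π.actionLaw ρ F (blockLoss γ ε h L σ) t).real (wrongSignSet (signVector h σ (t / L)) i) +
      (π.actionLaw ρ F (blockLoss γ ε h L (σ ∆ {(t / L, i)})) t).real
        (wrongSignSet (signVector h (σ ∆ {(t / L, i)}) (t / L)) i) := by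
  have := π.isProbabilityMeasure_actionLaw ρ F (measurable_blockLoss γ ε h L σ) t
  have := π.isProbabilityMeasure_actionLaw ρ F
    (measurable_blockLoss γ ε h L (σ ∆ {(t / L, i)})) t
  have hKL := π.klDiv_actionLaw_blockLoss_le (γ := γ) ρ hε hF hI₀ hv hL hK σ t (t / L) i
  have hK0 : 0 ≤ K := le_trans (by positivity) hK
  have htest := exp_neg_toReal_klDiv_div_two_le (ne_top_of_le_ne_top ENNReal.ofReal_ne_top hKL)
    (measurableSet_wrongSignSet (signVector h σ (t / L)) i)
  have hflip := compl_wrongSignSet_subset (signVector_symmDiff_singleton_self (h := h) σ (t / L) i)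
  refine le_trans ?_ (htest.trans (by gcongr; finiteness))
  gcongr
  exact ENNReal.toReal_le_of_le_ofReal hK0 hKL

variable {w : ℝ}

lemma sum_wrongSignSet_le_regret_blockLoss (hε : 0 ≤ ε) (hεγ : ε ≤ γ) (hw0 : 0 ≤ w)
    (hw : γ * w = ε * Real.cos w) (σ : Finset (ℕ × Fin d)) (T : ℕ) :
    (γ - ε) / 2 * (w * h) ^ 2 * ∑ j ∈ Finset.range T ×ˢ Finset.univ,
      (π.actionLaw ρ F (blockLoss γ ε h L σ) j.1).real
        (wrongSignSet (signVector h σ (j.1 / L)) j.2) ≤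
      π.regret ρ F (blockLoss γ ε h L σ) T fun t => w • signVector h σ (t / L) := by
  rw [π.regret_eq_sum_integral_actionLaw ρ F (continuous_blockLoss γ ε h L σ),
    Finset.sum_product, Finset.mul_sum]
  refine Finset.sum_le_sum fun t _ => ?_
  have := π.isProbabilityMeasure_actionLaw ρ F (measurable_blockLoss γ ε h L σ) t
  have hint := π.integrable_actionLaw ρ F (measurable_blockLoss γ ε h L σ) t
    (continuous_blockLoss γ ε h L σ t)
  refine le_of_eq_of_le ?_ (sum_measureReal_le_integral_perturbedLoss_sub hε hεγ hw0 hw hint)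
  simp only [mul_pow, signVector_apply_sq, Finset.mul_sum]

lemma exists_le_regret_blockLoss (hε : 0 ≤ ε) (hεγ : ε ≤ γ) (hw0 : 0 ≤ w)
    (hw : γ * w = ε * Real.cos w) (hF : ShiftKLCondition F I₀ v₀) (hI₀ : 0 ≤ I₀)
    (hv : ENNReal.ofReal (2 * ε * h ^ 2) < v₀) (hL : 0 < L)
    (hK : L * (I₀ * (2 * ε * h ^ 2) ^ 2) ≤ K) (T : ℕ) :
    ∃ σ : Finset (ℕ × Fin d),
      (γ - ε) / 2 * (w * h) ^ 2 * (T * d * (Real.exp (-K) / 4)) ≤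
        π.regret ρ F (blockLoss γ ε h L σ) T fun t => w • signVector h σ (t / L) := by
  obtain ⟨σ, hσ⟩ := exists_card_mul_le_sum (Finset.range T ×ˢ Finset.univ)
    (fun j : ℕ × Fin d => (j.1 / L, j.2)) (fun σ j =>
      (π.actionLaw ρ F (blockLoss γ ε h L σ) j.1).real
        (wrongSignSet (signVector h σ (j.1 / L)) j.2))
    fun σ j _ => π.exp_neg_div_two_le_measureReal_wrongSignSet_add (γ := γ) ρ hε hF hI₀ hv hL hK σ
      j.1 j.2
  refine ⟨σ, le_trans ?_ (π.sum_wrongSignSet_le_regret_blockLoss ρ hε hεγ hw0 hw σ T)⟩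
  have : 0 ≤ γ - ε := sub_nonneg.2 hεγ
  gcongr
  refine le_of_eq_of_le ?_ hσ
  rw [Finset.card_product, Finset.card_range, Finset.card_univ, Fintype.card_fin]
  push_cast
  ring

lemma le_iSup_pathRegret {α β M P : ℝ} {T : ℕ} (hε : 0 ≤ ε) (hεγ : ε ≤ γ) (hw0 : 0 ≤ w)
    (hw1 : w ≤ 1) (hw : γ * w = ε * Real.cos w) (hα : α ≤ γ - ε) (hβ : γ + ε ≤ β)
    (hM : γ / 4 + ε * (d * h ^ 2) ≤ M) (hF : ShiftKLCondition F I₀ v₀) (hI₀ : 0 ≤ I₀)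
    (hv : ENNReal.ofReal (2 * ε * h ^ 2) < v₀) (hL : 0 < L)
    (hK : L * (I₀ * (2 * ε * h ^ 2) ^ 2) ≤ K) (hh : 0 ≤ h) (hd : d * h ^ 2 ≤ 1)
    (hP : ((T - 1) / L : ℕ) * (2 * √d * h) ≤ P) :
    (((γ - ε) / 2 * (w * h) ^ 2 * (T * d * (Real.exp (-K) / 4)) : ℝ) : EReal) ≤
      ⨆ f ∈ {f : ℕ → Euc d → ℝ | ∀ t, f t ∈ lossClass d α β M}, pathRegret π ρ F f T P := by
  obtain ⟨σ, hσ⟩ := π.exists_le_regret_blockLoss ρ hε hεγ hw0 hw hF hI₀ hv hL hK T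
  refine le_iSup₂_of_le (blockLoss γ ε h L σ) (fun t =>
    perturbedLoss_mem_lossClass (hε.trans hεγ) hε hα hβ (by rwa [norm_signVector_sq])) ?_
  exact le_iSup₂_of_le _ (smul_signVector_mem_comparators σ hw0 hw1 hh hd hP)
    (EReal.coe_le_coe hσ)

end BanditAlgorithm

section Scale

open Filter Topology

lemma exists_nat_mul_le_one_le_two_mul {x : ℝ} (hx0 : 0 < x) (hx1 : x ≤ 1) :
    ∃ L : ℕ, 0 < L ∧ L * x ≤ 1 ∧ 1 ≤ 2 * (L * x) := by
  have hinv : 1 ≤ x⁻¹ := (one_le_inv₀ hx0).2 hx1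
  have hfloor : 1 ≤ ⌊x⁻¹⌋₊ := Nat.one_le_floor_iff _ |>.2 hinv
  refine ⟨⌊x⁻¹⌋₊, hfloor, ?_, ?_⟩
  · exact (le_div_iff₀ hx0).1 ((Nat.floor_le (by positivity)).trans_eq (inv_eq_one_div x))
  · have hlt : x⁻¹ < 2 * ⌊x⁻¹⌋₊ := by
      have : (1 : ℝ) ≤ ⌊x⁻¹⌋₊ := by exact_mod_cast hfloor
      linarith [Nat.lt_floor_add_one x⁻¹]
    linarith [(inv_lt_iff_one_lt_mul₀ hx0).1 hlt]

lemma rpow_mul_rpow_le_two_mul_of_eq {d T P h : ℝ} (hd : 0 ≤ d) (hT : 0 ≤ T) (hh : 0 ≤ h)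
    (hP : P = 4 * √d * T * h ^ 5) :
    (d ^ 2 * P) ^ (2 / 5 : ℝ) * T ^ (3 / 5 : ℝ) ≤ 2 * (T * (d * h ^ 2)) := by
  have hP0 : 0 ≤ P := hP ▸ by positivity
  have hroot {a : ℝ} (ha : 0 ≤ a) (n : ℕ) : (a ^ (n / 5 : ℝ)) ^ 5 = a ^ n := by
    rw [← Real.rpow_mul_natCast ha, ← Real.rpow_natCast a n]
    norm_num
  refine (pow_le_pow_iff_left₀ (by positivity) (by positivity) (NeZero.ne 5)).1 ?_
  calc ((d ^ 2 * P) ^ (2 / 5 : ℝ) * T ^ (3 / 5 : ℝ)) ^ 5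
      = (d ^ 2 * P) ^ 2 * T ^ 3 := by
        rw [mul_pow]
        exact congrArg₂ _ (mod_cast hroot (a := d ^ 2 * P) (by positivity) 2)
          (mod_cast hroot hT 3)
    _ = 16 * (d ^ 4 * √d ^ 2 * T ^ 5 * h ^ 10) := by rw [hP]; ring
    _ ≤ 32 * (d ^ 4 * √d ^ 2 * T ^ 5 * h ^ 10) := by gcongr; norm_num
    _ = (2 * (T * (d * h ^ 2))) ^ 5 := by rw [Real.sq_sqrt hd]; ring

lemma tendsto_div_natCast_rpow_nhdsGT {a s : ℝ} (ha : 0 < a) (hs : 0 < s) :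
    Tendsto (fun T : ℕ => (a / T) ^ s) atTop (𝓝[>] 0) := by
  refine tendsto_nhdsWithin_iff.2 ⟨?_, ?_⟩
  · simpa [Real.zero_rpow hs.ne'] using
      (tendsto_const_div_atTop_nhds_zero_nat a).rpow_const (.inr hs.le)
  · filter_upwards [eventually_gt_atTop 0] with T hT
    exact Real.rpow_pos_of_pos (by positivity) s

lemma eventually_exists_scale {d : ℕ} (hd : 0 < d) {P : ℝ} (hP : 0 ≤ P) {p : ℝ → Prop}
    (hp : ∀ᶠ h in 𝓝[>] (0 : ℝ), p h) :
    ∀ᶠ T : ℕ in atTop, ∃ L : ℕ, ∃ h : ℝ, 0 < L ∧ 0 < h ∧ p h ∧ L * h ^ 4 ≤ 1 ∧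
      ((T - 1) / L : ℕ) * (2 * √d * h) ≤ P ∧
      ((d : ℝ) ^ 2 * P) ^ (2 / 5 : ℝ) * (T : ℝ) ^ (3 / 5 : ℝ) ≤ 2 * (T * (d * h ^ 2)) := by
  rcases hP.eq_or_lt with rfl | hP
  · filter_upwards [eventually_gt_atTop 0] with T hT
    have hsmall : ∀ᶠ h : ℝ in 𝓝[>] 0, T * h ^ 4 < 1 := by
      have hlim : Tendsto (fun h : ℝ => T * h ^ 4) (𝓝 0) (𝓝 0) :=
        Continuous.tendsto' (by fun_prop) _ _ (by simp)
      exact eventually_nhdsWithin_of_eventually_nhds (hlim.eventually_lt_const one_pos)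
    obtain ⟨h, ⟨hph, hTh⟩, hh⟩ := ((hp.and hsmall).and self_mem_nhdsWithin).exists
    refine ⟨T, h, hT, hh, hph, hTh.le, ?_, ?_⟩
    · rw [Nat.div_eq_of_lt (by lia), Nat.cast_zero, zero_mul]
    · rw [mul_zero, Real.zero_rpow (by norm_num), zero_mul]
      positivity
  · have hd' : (0 : ℝ) < d := Nat.cast_pos.2 hd
    have hlim := tendsto_div_natCast_rpow_nhdsGT (a := P / (4 * √d)) (s := (5 : ℕ)⁻¹)
      (by positivity) (by positivity)
    filter_upwards [hlim.eventually (hp.and (Ioc_mem_nhdsGT one_pos)), eventually_gt_atTop 0]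
      with T ⟨hph, hh0, hh1⟩ hT
    set h := (P / (4 * √d) / T) ^ ((5 : ℕ)⁻¹ : ℝ) with hh
    have hT' : (0 : ℝ) < T := Nat.cast_pos.2 hT
    have hPh : P = 4 * √d * T * h ^ 5 := by
      rw [hh, Real.rpow_inv_natCast_pow (by positivity) (NeZero.ne 5)]
      field_simp
    obtain ⟨L, hL, hLh, hLh'⟩ := exists_nat_mul_le_one_le_two_mul (pow_pos hh0 4)
      (pow_le_one₀ hh0.le hh1)
    refine ⟨L, h, hL, hh0, hph, hLh, ?_, rpow_mul_rpow_le_two_mul_of_eq hd'.le hT'.le hh0.le hPh⟩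
    have : (0 : ℝ) < L := Nat.cast_pos.2 hL
    calc ((T - 1) / L : ℕ) * (2 * √d * h) ≤ (T / L : ℝ) * (2 * √d * h) := by
          gcongr
          exact Nat.cast_div_le.trans (by gcongr; lia)
      _ ≤ (T / L : ℝ) * (2 * √d * h) * (2 * (L * h ^ 4)) :=
          le_mul_of_one_le_right (by positivity) hLh'
      _ = P := by rw [hPh]; field_simp; ring

lemma eventually_perturbation_admissible (d : ℕ) {γ M : ℝ} (ε : ℝ) {v₀ : ℝ≥0∞} (hM : γ / 4 < M)
    (hv₀ : 0 < v₀) :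
    ∀ᶠ h in 𝓝[>] (0 : ℝ), γ / 4 + ε * (d * h ^ 2) ≤ M ∧ ENNReal.ofReal (2 * ε * h ^ 2) < v₀ ∧
      d * h ^ 2 ≤ 1 := by
  have hloss : Tendsto (fun h => γ / 4 + ε * (d * h ^ 2)) (𝓝 0) (𝓝 (γ / 4)) :=
    Continuous.tendsto' (by fun_prop) _ _ (by simp)
  have hshift : Tendsto (fun h => ENNReal.ofReal (2 * ε * h ^ 2)) (𝓝 0) (𝓝 0) :=
    (ENNReal.continuous_ofReal.comp (by fun_prop)).tendsto' _ _ (by simp)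
  have hnorm : Tendsto (fun h : ℝ => d * h ^ 2) (𝓝 0) (𝓝 0) :=
    Continuous.tendsto' (by fun_prop) _ _ (by simp)
  refine eventually_nhdsWithin_of_eventually_nhds ?_
  exact (hloss.eventually_le_const hM).and
    ((hshift.eventually_lt_const hv₀).and (hnorm.eventually_le_const one_pos))

end Scale

theorem mainTheorem4 (α β M I₀ : ℝ) (v₀ : ℝ≥0∞) (hα : 0 < α) (hαβ : α < β) (hαM : α < 4 * M)
    (hI₀ : 0 < I₀) (hv₀ : 0 < v₀) :
    ∃ c₂ : ℝ, 0 < c₂ ∧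
      ∀ (d : ℕ) (P : ℝ), 1 ≤ d → 0 ≤ P →
        ∃ T₀ : ℕ, 0 < T₀ ∧ ∀ T : ℕ, T₀ ≤ T →
          ∀ (F : Measure ℝ) [IsProbabilityMeasure F], ShiftKLCondition F I₀ v₀ →
            ∀ (S : Type*) [MeasurableSpace S] (ρ : Measure S) [IsProbabilityMeasure ρ]
              (π : BanditAlgorithm d S),
              ((c₂ * ((d : ℝ) ^ 2 * P) ^ (2 / 5 : ℝ) * (T : ℝ) ^ (3 / 5 : ℝ) : ℝ) : EReal) ≤
                ⨆ f ∈ {f : ℕ → Euc d → ℝ | ∀ t, f t ∈ lossClass d α β M},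
                  pathRegret π ρ F f T P := by
  obtain ⟨ε, hε, hεβM⟩ := exists_between (lt_min (half_pos (sub_pos.2 hαβ)) (sub_pos.2 hαM))
  obtain ⟨hεβ, hεM⟩ := lt_min_iff.1 hεβM
  obtain ⟨w, hw0, hw1, hw⟩ := exists_mul_eq_mul_cos hε (le_add_of_nonneg_left hα.le : ε ≤ α + ε)
  set K := 4 * I₀ * ε ^ 2
  set c := α / 2 * w ^ 2 * (Real.exp (-K) / 4) with hc
  have hc0 : 0 < c := by positivity
  refine ⟨c / 2, half_pos hc0, fun d P hd hP => ?_⟩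
  obtain ⟨T₁, hT₁⟩ := Filter.eventually_atTop.1 (eventually_exists_scale hd hP
    (eventually_perturbation_admissible d ε (by linarith : (α + ε) / 4 < M) hv₀))
  refine ⟨T₁ + 1, T₁.succ_pos, fun T hT F _ hF S _ ρ _ π => ?_⟩
  obtain ⟨L, h, hL, hh, ⟨hM, hv, hdh⟩, hLh, hLP, hrate⟩ := hT₁ T (by lia)
  have hLK : L * (I₀ * (2 * ε * h ^ 2) ^ 2) ≤ K := by
    calc L * (I₀ * (2 * ε * h ^ 2) ^ 2) = K * (L * h ^ 4) := by ring
      _ ≤ K := mul_le_of_le_one_right (by positivity) hLh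
  refine le_trans (EReal.coe_le_coe ?_) (π.le_iSup_pathRegret ρ hε.le (by linarith) hw0.le hw1 hw
    (by linarith) (by linarith) hM hF hI₀.le hv hL hLK hh.le hdh hLP)
  calc c / 2 * ((d : ℝ) ^ 2 * P) ^ (2 / 5 : ℝ) * (T : ℝ) ^ (3 / 5 : ℝ)
      = c / 2 * (((d : ℝ) ^ 2 * P) ^ (2 / 5 : ℝ) * (T : ℝ) ^ (3 / 5 : ℝ)) := mul_assoc _ _ _
    _ ≤ c / 2 * (2 * (T * (d * h ^ 2))) := by gcongr
    _ = (α + ε - ε) / 2 * (w * h) ^ 2 * (T * d * (Real.exp (-K) / 4)) := by rw [hc]; ring
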